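/- Let $m \ge 0$ be an integer and let $a, b_1,\dots,b_m, c_1,\dots,c_m \in \mathbb{C}$ be arbitrary. Put $\theta_{x_i} = x_i \partial_{x_i}$, and let $$\ell_i^A = \theta_{x_i}(\theta_{x_i} + c_i - 1) - x_i(\theta_{x_1} + \cdots + \theta_{x_m} + a)(\theta_{x_i} + b_i) \qquad (i = 1,\dots,m)$$ be the operators annihilating Lauricella's series $F_A$. Let $D = \mathbb{C}[X_1,\dots,X_m]\langle \partial_{X_1},\dots,\partial_{X_m}\rangle$ be the Weyl algebra, $\theta_{X_i} = X_i\partial_{X_i}$, and $$p_i^A = X_i\,\theta_{X_i}(-\theta_{X_i} + c_i - 1) + (\theta_{X_1} + \cdots + \theta_{X_m} - a)(\theta_{X_i} - b_i) \in D \qquad (i = 1,\dots,m).$$ Every $P \in D$ has a unique expansion $P = \sum c_{\alpha\beta} X^\alpha \partial_X^\beta$; its terms are viewed as $c_{\alpha\beta} X^\alpha \xi^\beta \in \mathbb{C}[X,\xi]$ with commuting variables $\xi_1,\dots,\xi_m$. Given any term order $<'$ on the monomials $X^\alpha \xi^\beta$ as tie-breaker, let $<_{(\mathbf 0,\mathbf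 1)}$ be the term order that compares first $|\beta| = \beta_1+\cdots+\beta_m$, then $|\alpha| = \alpha_1+\cdots+\alpha_m$, and then uses $<'$. The initial term $\mathrm{in}_<(P)$ is the largest term of $P$ with its coefficient. A Gröbner basis of a left ideal $I \subseteq D$ is a finite set $G$ that generates $I$ as a left ideal and is such that $\{\mathrm{in}_<(g) : g \in G\}$ generates the ideal $\langle \mathrm{in}_<(P) : P \in I \rangle$ of $\mathbb{C}[X,\xi]$. The $(\mathbf 0,\mathbf 1)$-initial form of $P$ is the sum of the terms $c_{\alpha\beta}X^\alpha\xi^\beta$ of $P$ with $|\beta|$ maximal. Then: 1. Under the change of coordinates $X_i = 1/x_i$ on the torus $(\mathbb{C}^*)^m$, the operator $\ell_i^A$ becomes $-X_i^{-1} p_i^A$; that is, $p_i^A$ equals $-X_i$ times the transform of $\ell_i^A$, as operators on Laurent polynomials. 2. For every tie-breaking term order $<'$, the set $\{p_1^A,\dots,p_m^A\}$ is a Gröbner basis, with respect to $<_{(\mathbf 0,\mathbf 1)}$, of the left ideal $I_A(m)' = D\cdot\{p_1^A,\dots,p_m^A\}$. 3. For all $i$ and all parameters $a_1',\dots,a_m',b_1',\dots,b_m',c'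 \in \mathbb{C}$, the $(\mathbf 0,\mathbf 1)$-initial form of $p_i^A$ coincides with that of $$\ell_i^B = \theta_{X_i}(\theta_{X_1} + \cdots + \theta_{X_m} + c' - 1) - X_i(\theta_{X_i} + a_i')(\theta_{X_i} + b_i'),$$ the operator of Lauricella's $F_B$ written in the variables $X$. -/

import Mathlib

open scoped MonomialOrder

noncomputable section

namespace Lauricella

/-! ### The Weyl algebra -/

/-- Multiplication by the variable `x_i`, acting on `ℂ[x_1, …, x_m]`. -/
def mulX {m : ℕ} (i : Fin m) : Module.End ℂ (MvPolynomial (Fin m) ℂ) :=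
  LinearMap.mulLeft ℂ (MvPolynomial.X i)

/-- The partial derivative `∂_i`, acting on `ℂ[x_1, …, x_m]`. -/
def partialD {m : ℕ} (i : Fin m) : Module.End ℂ (MvPolynomial (Fin m) ℂ) :=
  (MvPolynomial.pderiv i : Derivation ℂ (MvPolynomial (Fin m) ℂ) (MvPolynomial (Fin m) ℂ))

/-- The Weyl algebra `D = ℂ[x_1, …, x_m]⟨∂_1, …, ∂_m⟩` of differential operators with polynomial
coefficients: the algebra of operators on polynomials generated by the `x_i` and the `∂_i`. -/
def WeylAlgebra (m : ℕ) : Subalgebra ℂ (Module.End ℂ (MvPolynomial (Fin m) ℂ)) :=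
  Algebra.adjoin ℂ (Set.range mulX ∪ Set.range partialD)

/-- The element `x_i` of `D`. -/
def x {m : ℕ} (i : Fin m) : WeylAlgebra m :=
  ⟨mulX i, Algebra.subset_adjoin (Or.inl ⟨i, rfl⟩)⟩

/-- The element `∂_i` of `D`. -/
def d {m : ℕ} (i : Fin m) : WeylAlgebra m :=
  ⟨partialD i, Algebra.subset_adjoin (Or.inr ⟨i, rfl⟩)⟩

theorem x_apply {m : ℕ} (i : Fin m) (f : MvPolynomial (Fin m) ℂ) :
    (x i : WeylAlgebra m).1 f = MvPolynomial.X i * f := rfl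

theorem d_apply {m : ℕ} (i : Fin m) (f : MvPolynomial (Fin m) ℂ) :
    (d i : WeylAlgebra m).1 f = MvPolynomial.pderiv i f := rfl

theorem x_comm {m : ℕ} (i j : Fin m) : Commute (x i) (x j) := by
  apply Subtype.ext
  apply LinearMap.ext
  intro f
  change MvPolynomial.X i * (MvPolynomial.X j * f) = MvPolynomial.X j * (MvPolynomial.X i * f)
  ring

theorem d_apply_monomial {m : ℕ} (i : Fin m) (γ : Fin m →₀ ℕ) (c : ℂ) :
    (d i : WeylAlgebra m).1 (MvPolynomial.monomial γ c) =
      MvPolynomial.monomial (γ - Finsupp.single i 1) (c * γ i) := by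
  rw [d_apply, MvPolynomial.pderiv_monomial]

theorem d_comm {m : ℕ} (i j : Fin m) : Commute (d i) (d j) := by
  apply Subtype.ext
  apply MvPolynomial.linearMap_ext
  intro γ
  apply LinearMap.ext
  intro c
  change (d i).1 ((d j).1 (MvPolynomial.monomial γ c)) =
    (d j).1 ((d i).1 (MvPolynomial.monomial γ c))
  simp only [d_apply_monomial]
  by_cases h : i = j
  · subst h; rfl
  · refine congrArg₂ (fun s e => MvPolynomial.monomial s e) ?_ ?_
    · ext k; simp only [Finsupp.coe_tsub, Pi.sub_apply]; omega
    · simp [h, Ne.symm h]; ring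

/-! ### Normally ordered expansions -/

theorem x_pow_comm {m : ℕ} (α : Fin m →₀ ℕ) :
    ((Finset.univ : Finset (Fin m)) : Set (Fin m)).Pairwise
      (Function.onFun Commute fun i => x i ^ α i) :=
  fun i _ j _ _ => (x_comm i j).pow_pow _ _

theorem d_pow_comm {m : ℕ} (β : Fin m →₀ ℕ) :
    ((Finset.univ : Finset (Fin m)) : Set (Fin m)).Pairwise
      (Function.onFun Commute fun i => d i ^ β i) :=
  fun i _ j _ _ => (d_comm i j).pow_pow _ _

/-- `x^α = x_1^{α_1} ⋯ x_m^{α_m}` in `D`. -/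
def xPow {m : ℕ} (α : Fin m →₀ ℕ) : WeylAlgebra m :=
  Finset.univ.noncommProd (fun i => x i ^ α i) (x_pow_comm α)

/-- `∂^β = ∂_1^{β_1} ⋯ ∂_m^{β_m}` in `D`. -/
def dPow {m : ℕ} (β : Fin m →₀ ℕ) : WeylAlgebra m :=
  Finset.univ.noncommProd (fun i => d i ^ β i) (d_pow_comm β)

theorem xPow_zero {m : ℕ} : xPow (0 : Fin m →₀ ℕ) = 1 := by
  unfold xPow
  rw [Finset.noncommProd_eq_pow_card _ _ _ (1 : WeylAlgebra m) (by simp)]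
  simp

theorem dPow_zero {m : ℕ} : dPow (0 : Fin m →₀ ℕ) = 1 := by
  unfold dPow
  rw [Finset.noncommProd_eq_pow_card _ _ _ (1 : WeylAlgebra m) (by simp)]
  simp

theorem xPow_add {m : ℕ} (α β : Fin m →₀ ℕ) : xPow (α + β) = xPow α * xPow β := by
  unfold xPow
  rw [← Finset.noncommProd_mul_distrib _ _ (x_pow_comm α) (x_pow_comm β)
    fun i _ j _ _ => (x_comm i j).pow_pow _ _]
  exact Finset.noncommProd_congr rfl (fun i _ => by simp [pow_add]) _

theorem dPow_add {m : ℕ} (α β : Fin m →₀ ℕ) : dPow (α + β) = dPow α * dPow β := by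
  unfold dPow
  rw [← Finset.noncommProd_mul_distrib _ _ (d_pow_comm α) (d_pow_comm β)
    fun i _ j _ _ => (d_comm i j).pow_pow _ _]
  exact Finset.noncommProd_congr rfl (fun i _ => by simp [pow_add]) _

theorem xPow_single {m : ℕ} (i : Fin m) : xPow (Finsupp.single i 1) = x i := by
  unfold xPow
  refine (Finset.noncommProd_erase_mul _ (Finset.mem_univ i) _ (x_pow_comm _)).symm.trans ?_
  refine (congrArg (· * _) (Finset.noncommProd_eq_pow_card _ _ _ (1 : WeylAlgebra m) ?_)).trans ?_
  · intro j hj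
    simp [(Finset.ne_of_mem_erase hj).symm]
  · simp

theorem dPow_single {m : ℕ} (i : Fin m) : dPow (Finsupp.single i 1) = d i := by
  unfold dPow
  refine (Finset.noncommProd_erase_mul _ (Finset.mem_univ i) _ (d_pow_comm _)).symm.trans ?_
  refine (congrArg (· * _) (Finset.noncommProd_eq_pow_card _ _ _ (1 : WeylAlgebra m) ?_)).trans ?_
  · intro j hj
    simp [(Finset.ne_of_mem_erase hj).symm]
  · simp

/-- Monomials `x^α ξ^β` of `ℂ[x, ξ]`: `Sum.inl i` indexes `x_i` and `Sum.inr i` indexes `ξ_i`. -/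
abbrev Vars (m : ℕ) := Fin m ⊕ Fin m

/-- The exponent of `x` in a monomial `x^α ξ^β`. -/
def xExp {m : ℕ} (s : Vars m →₀ ℕ) : Fin m →₀ ℕ := (Finsupp.sumFinsuppAddEquivProdFinsupp s).1

/-- The exponent of `ξ` in a monomial `x^α ξ^β`. -/
def xiExp {m : ℕ} (s : Vars m →₀ ℕ) : Fin m →₀ ℕ := (Finsupp.sumFinsuppAddEquivProdFinsupp s).2

/-- The `ℂ`-linear map `∑ c_{αβ} x^α ξ^β ↦ ∑ c_{αβ} x^α ∂^β` from `ℂ[x, ξ]` to `D`. -/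
def normalOrder (m : ℕ) : MvPolynomial (Vars m) ℂ →ₗ[ℂ] WeylAlgebra m :=
  (MvPolynomial.basisMonomials (Vars m) ℂ).constr ℂ fun s => xPow (xExp s) * dPow (xiExp s)

theorem normalOrder_monomial {m : ℕ} (s : Vars m →₀ ℕ) (c : ℂ) :
    normalOrder m (MvPolynomial.monomial s c) = c • (xPow (xExp s) * dPow (xiExp s)) := by
  have h : MvPolynomial.monomial s c = c • (MvPolynomial.basisMonomials (Vars m) ℂ) s := by
    rw [MvPolynomial.coe_basisMonomials, MvPolynomial.smul_monomial, smul_eq_mul, mul_one]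
  rw [h, map_smul, normalOrder, Module.Basis.constr_basis]

theorem xPow_mul_dPow_mem {m : ℕ} (α β : Fin m →₀ ℕ) :
    xPow α * dPow β ∈ LinearMap.range (normalOrder m) := by
  refine ⟨MvPolynomial.monomial (Finsupp.sumFinsuppAddEquivProdFinsupp.symm (α, β)) 1, ?_⟩
  rw [normalOrder_monomial, one_smul, xExp, xiExp, AddEquiv.apply_symm_apply]

theorem xPow_apply {m : ℕ} (α : Fin m →₀ ℕ) (f : MvPolynomial (Fin m) ℂ) :
    (xPow α).1 f = MvPolynomial.monomial α 1 * f := by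
  induction α using Finsupp.induction_linear generalizing f with
  | zero => rw [xPow_zero]; simp
  | add α β hα hβ =>
    rw [xPow_add]
    change (xPow α).1 ((xPow β).1 f) = _
    rw [hα, hβ, ← mul_assoc, MvPolynomial.monomial_mul, one_mul]
  | single i n =>
    induction n generalizing f with
    | zero => rw [Finsupp.single_zero, xPow_zero]; simp
    | succ n ih =>
      rw [Finsupp.single_add, xPow_add, xPow_single]
      change (xPow _).1 ((x i).1 f) = _
      rw [ih, x_apply, ← mul_assoc, MvPolynomial.X, MvPolynomial.monomial_mul, one_mul]

theorem d_mul_xPow {m : ℕ} (i : Fin m) (α : Fin m →₀ ℕ) :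
    d i * xPow α = xPow α * d i + (α i : ℂ) • xPow (α - Finsupp.single i 1) := by
  apply Subtype.ext
  apply LinearMap.ext
  intro f
  change (d i).1 ((xPow α).1 f) = (xPow α).1 ((d i).1 f) +
    (α i : ℂ) • (xPow (α - Finsupp.single i 1)).1 f
  simp only [xPow_apply, d_apply]
  rw [Derivation.leibniz, MvPolynomial.pderiv_monomial, smul_eq_mul, smul_eq_mul, one_mul,
    ← smul_mul_assoc, MvPolynomial.smul_monomial, smul_eq_mul, mul_one, mul_comm f]

theorem normalOrder_surjective (m : ℕ) : Function.Surjective (normalOrder m) := by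
  have key : ∀ P ∈ WeylAlgebra m, ∀ Q ∈ LinearMap.range (normalOrder m),
      ∀ P' : WeylAlgebra m, P'.1 = P → P' * Q ∈ LinearMap.range (normalOrder m) := by
    intro P hP
    induction hP using Algebra.adjoin_induction with
    | mem P hP =>
      rintro _ ⟨f, rfl⟩ P' hP'
      induction f using MvPolynomial.induction_on' with
      | add f g hf hg => rw [map_add, mul_add]; exact add_mem hf hg
      | monomial s c =>
        rw [normalOrder_monomial, mul_smul_comm]
        apply Submodule.smul_mem
        rcases hP with ⟨i, rfl⟩ | ⟨i, rfl⟩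
        · obtain rfl : P' = x i := Subtype.ext hP'
          rw [← mul_assoc, ← xPow_single, ← xPow_add]
          exact xPow_mul_dPow_mem _ _
        · obtain rfl : P' = d i := Subtype.ext hP'
          rw [← mul_assoc, d_mul_xPow, add_mul, mul_assoc, smul_mul_assoc, ← dPow_single,
            ← dPow_add]
          exact add_mem (xPow_mul_dPow_mem _ _) (Submodule.smul_mem _ _ (xPow_mul_dPow_mem _ _))
    | algebraMap r =>
      intro Q hQ P' hP'
      obtain rfl : P' = algebraMap ℂ _ r := Subtype.ext hP'
      rw [← Algebra.smul_def]
      exact Submodule.smul_mem _ _ hQ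
    | add P₁ P₂ h₁ h₂ ih₁ ih₂ =>
      intro Q hQ P' hP'
      obtain rfl : P' = ⟨P₁, h₁⟩ + ⟨P₂, h₂⟩ := Subtype.ext hP'
      rw [add_mul]
      exact add_mem (ih₁ Q hQ _ rfl) (ih₂ Q hQ _ rfl)
    | mul P₁ P₂ h₁ h₂ ih₁ ih₂ =>
      intro Q hQ P' hP'
      obtain rfl : P' = ⟨P₁, h₁⟩ * ⟨P₂, h₂⟩ := Subtype.ext hP'
      rw [mul_assoc]
      exact ih₁ _ (ih₂ Q hQ _ rfl) _ rfl
  intro P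
  have h1 : (1 : WeylAlgebra m) ∈ LinearMap.range (normalOrder m) := by
    have := xPow_mul_dPow_mem (0 : Fin m →₀ ℕ) 0
    rwa [xPow_zero, dPow_zero, one_mul] at this
  simpa using key P.1 P.2 1 h1 P rfl

theorem dPow_apply_monomial {m : ℕ} (β γ : Fin m →₀ ℕ) (c : ℂ) :
    (dPow β).1 (MvPolynomial.monomial γ c) =
      MvPolynomial.monomial (γ - β) (c * ∏ i, (((γ i).descFactorial (β i) : ℕ) : ℂ)) := by
  have hsingle : ∀ (i : Fin m) (n : ℕ) (β γ : Fin m →₀ ℕ) (c : ℂ),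
      (dPow β).1 (MvPolynomial.monomial γ c) =
        MvPolynomial.monomial (γ - β) (c * ∏ i, (((γ i).descFactorial (β i) : ℕ) : ℂ)) →
      (dPow (β + Finsupp.single i n)).1 (MvPolynomial.monomial γ c) =
        MvPolynomial.monomial (γ - (β + Finsupp.single i n))
          (c * ∏ j, (((γ j).descFactorial ((β + Finsupp.single i n) j) : ℕ) : ℂ)) := by
    intro i n β γ c h
    induction n with
    | zero => simpa using h
    | succ n ih =>
      have e : β + Finsupp.single i (n + 1) = Finsupp.single i 1 + (β + Finsupp.single i n) := by
        rw [add_comm n 1, Finsupp.single_add]; abel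
      rw [e, dPow_add, dPow_single]
      change (d i).1 ((dPow _).1 _) = _
      rw [ih, d_apply_monomial]
      refine congrArg₂ (fun s e => MvPolynomial.monomial s e) ?_ ?_
      · ext k; simp only [Finsupp.coe_tsub, Finsupp.coe_add, Pi.sub_apply, Pi.add_apply]; omega
      · rw [mul_assoc]
        congr 1
        rw [← Finset.prod_erase_mul Finset.univ
            (fun j => (((γ j).descFactorial ((β + Finsupp.single i n) j) : ℕ) : ℂ))
            (Finset.mem_univ i),
          ← Finset.prod_erase_mul Finset.univ
            (fun j => (((γ j).descFactorial
              ((Finsupp.single i 1 + (β + Finsupp.single i n) : Fin m →₀ ℕ) j) : ℕ) : ℂ))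
            (Finset.mem_univ i), mul_assoc]
        congr 1
        · refine Finset.prod_congr rfl fun j hj => ?_
          have : i ≠ j := (Finset.ne_of_mem_erase hj).symm
          simp [this]
        · have : (Finsupp.single i 1 + (β + Finsupp.single i n) : Fin m →₀ ℕ) i =
              (β + Finsupp.single i n) i + 1 := by simp; omega
          rw [this, Nat.descFactorial_succ, Finsupp.coe_tsub, Pi.sub_apply]
          push_cast
          ring
  induction β using Finsupp.induction with
  | zero => rw [dPow_zero]; simp
  | single_add i n β _ _ ih =>
    rw [add_comm]
    exact hsingle i n β γ c ih

theorem normalOrder_injective (m : ℕ) : Function.Injective (normalOrder m) := by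
  rw [injective_iff_map_eq_zero]
  intro f hf
  by_contra hne
  obtain ⟨s₀, hs₀, hmin⟩ := Finset.exists_min_image f.support
    (fun s => (xiExp s).degree) (MvPolynomial.support_nonempty.mpr hne)
  have h0 : (normalOrder m f).1 (MvPolynomial.monomial (xiExp s₀) 1) = 0 := by rw [hf]; rfl
  rw [f.as_sum, map_sum, AddSubmonoidClass.coe_finsetSum, LinearMap.sum_apply] at h0
  have h1 := congrArg (MvPolynomial.coeff (xExp s₀)) h0
  rw [MvPolynomial.coeff_sum, MvPolynomial.coeff_zero, Finset.sum_eq_single s₀] at h1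
  · rw [normalOrder_monomial] at h1
    change MvPolynomial.coeff _ (f.coeff s₀ • (xPow (xExp s₀)).1 ((dPow (xiExp s₀)).1 _)) = 0 at h1
    rw [dPow_apply_monomial, xPow_apply, MvPolynomial.monomial_mul, tsub_self, add_zero,
      MvPolynomial.coeff_smul, MvPolynomial.coeff_monomial, if_pos rfl] at h1
    simp only [Nat.descFactorial_self, one_mul, smul_eq_mul, mul_eq_zero] at h1
    rcases h1 with h1 | h1
    · exact MvPolynomial.mem_support_iff.mp hs₀ h1
    · rw [Finset.prod_eq_zero_iff] at h1
      obtain ⟨i, _, hi⟩ := h1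
      exact Nat.factorial_ne_zero _ (Nat.cast_eq_zero.mp hi)
  · intro s hs hss
    rw [normalOrder_monomial]
    change MvPolynomial.coeff _ (f.coeff s • (xPow (xExp s)).1 ((dPow (xiExp s)).1 _)) = 0
    rw [dPow_apply_monomial, xPow_apply, MvPolynomial.monomial_mul, MvPolynomial.coeff_smul,
      MvPolynomial.coeff_monomial]
    split_ifs with hx
    · by_cases hle : xiExp s ≤ xiExp s₀
      · exfalso
        have hd := hmin s hs
        have he : xiExp s = xiExp s₀ := by
          have h2 : (xiExp s₀ - xiExp s).degree + (xiExp s).degree = (xiExp s₀).degree := by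
            rw [← map_add, tsub_add_cancel_of_le hle]
          have h3 : (xiExp s₀ - xiExp s).degree = 0 := by omega
          rw [Finsupp.degree_eq_zero_iff] at h3
          exact le_antisymm hle (tsub_eq_zero_iff_le.mp h3)
        rw [he, tsub_self, add_zero] at hx
        apply hss
        apply Finsupp.sumFinsuppAddEquivProdFinsupp.injective
        exact Prod.ext hx he
      · obtain ⟨i, hi⟩ : ∃ i, xiExp s₀ i < xiExp s i := by
          by_contra hcon
          push Not at hcon
          exact hle hcon
        rw [Finset.prod_eq_zero (Finset.mem_univ i)
          (by rw [Nat.descFactorial_of_lt hi, Nat.cast_zero])]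
        simp
    · simp
  · intro h; exact absurd hs₀ h

/-- Every `P ∈ D` has a unique expansion `P = ∑ c_{αβ} x^α ∂^β`; its total symbol is
`∑ c_{αβ} x^α ξ^β ∈ ℂ[x, ξ]`. -/
def symbol (m : ℕ) : WeylAlgebra m ≃ₗ[ℂ] MvPolynomial (Vars m) ℂ :=
  (LinearEquiv.ofBijective (normalOrder m)
    ⟨normalOrder_injective m, normalOrder_surjective m⟩).symm

/-! ### The term order and Gröbner bases -/

/-- The type of exponents of monomials of `ℂ[x, ξ]`, to be ordered by `<_{(0,1)}` with the
tie-breaking term order `t`. -/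
def ZeroOneSyn {m : ℕ} (_t : MonomialOrder (Vars m)) : Type := Vars m →₀ ℕ

instance {m : ℕ} (t : MonomialOrder (Vars m)) : AddCommMonoid (ZeroOneSyn t) :=
  inferInstanceAs (AddCommMonoid (Vars m →₀ ℕ))

/-- The key `(|β|, |α|, x^α ξ^β)` of a monomial, compared lexicographically. -/
def zeroOneKey {m : ℕ} (t : MonomialOrder (Vars m)) (s : Vars m →₀ ℕ) : ℕ ×ₗ (ℕ ×ₗ t.syn) :=
  toLex ((xiExp s).degree, toLex ((xExp s).degree, t.toSyn s))

theorem zeroOneKey_injective {m : ℕ} (t : MonomialOrder (Vars m)) :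
    Function.Injective (zeroOneKey t) := by
  intro s s' h
  simp only [zeroOneKey, EmbeddingLike.apply_eq_iff_eq, Prod.mk.injEq] at h
  exact h.2.2

instance {m : ℕ} (t : MonomialOrder (Vars m)) : LinearOrder (ZeroOneSyn t) :=
  LinearOrder.lift' (fun s : ZeroOneSyn t => zeroOneKey t s) (zeroOneKey_injective t)

theorem xExp_add {m : ℕ} (s s' : Vars m →₀ ℕ) : xExp (s + s') = xExp s + xExp s' := by
  rw [xExp, map_add]; rfl

theorem xiExp_add {m : ℕ} (s s' : Vars m →₀ ℕ) : xiExp (s + s') = xiExp s + xiExp s' := by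
  rw [xiExp, map_add]; rfl

theorem zeroOneKey_add {m : ℕ} (t : MonomialOrder (Vars m)) (s s' : Vars m →₀ ℕ) :
    zeroOneKey t (s + s') = zeroOneKey t s + zeroOneKey t s' := by
  rw [zeroOneKey, xExp_add, xiExp_add, map_add, map_add, map_add]
  rfl

instance {m : ℕ} (t : MonomialOrder (Vars m)) : IsOrderedAddMonoid (ZeroOneSyn t) where
  add_le_add_left s s' h u := by
    have h' : zeroOneKey t s ≤ zeroOneKey t s' := h
    have h'' := add_le_add_left h' (zeroOneKey t u)
    exact (zeroOneKey_add t s u).trans_le (h''.trans_eq (zeroOneKey_add t s' u).symm)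

instance {m : ℕ} (t : MonomialOrder (Vars m)) : WellFoundedLT (ZeroOneSyn t) :=
  ⟨InvImage.wf (zeroOneKey t) wellFounded_lt⟩

/-- The term order `<_{(0,1)}` on monomials `x^α ξ^β`: compare `|β|` first, then `|α|`, then use
the tie-breaking term order `t`. -/
def zeroOneOrder {m : ℕ} (t : MonomialOrder (Vars m)) : MonomialOrder (Vars m) where
  syn := ZeroOneSyn t
  toSyn := { toEquiv := Equiv.refl (Vars m →₀ ℕ), map_add' := fun _ _ => rfl }
  toSyn_monotone s s' h := by
    obtain ⟨u, rfl⟩ := exists_add_of_le h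
    change zeroOneKey t s ≤ zeroOneKey t (s + u)
    simp only [zeroOneKey, xExp_add, xiExp_add, map_add, Prod.Lex.toLex_le_toLex]
    have h3 : t.toSyn s ≤ t.toSyn s + t.toSyn u := t.le_add_right s u
    rcases Nat.eq_zero_or_pos (xiExp u).degree with h1 | h1
    · rcases Nat.eq_zero_or_pos (xExp u).degree with h2 | h2
      · exact Or.inr ⟨by omega, Or.inr ⟨by omega, h3⟩⟩
      · exact Or.inr ⟨by omega, Or.inl (by omega)⟩
    · exact Or.inl (by omega)

theorem zeroOneOrder_lt_iff {m : ℕ} (t : MonomialOrder (Vars m)) (s s' : Vars m →₀ ℕ) :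
    s ≺[zeroOneOrder t] s' ↔
      ∑ i, s (Sum.inr i) < ∑ i, s' (Sum.inr i) ∨
      (∑ i, s (Sum.inr i) = ∑ i, s' (Sum.inr i) ∧ ∑ i, s (Sum.inl i) < ∑ i, s' (Sum.inl i)) ∨
      (∑ i, s (Sum.inr i) = ∑ i, s' (Sum.inr i) ∧ ∑ i, s (Sum.inl i) = ∑ i, s' (Sum.inl i) ∧
        s ≺[t] s') := by
  change zeroOneKey t s < zeroOneKey t s' ↔ _
  simp only [zeroOneKey, Prod.Lex.toLex_lt_toLex, Finsupp.degree_eq_sum]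
  change (∑ i, s (Sum.inr i) < ∑ i, s' (Sum.inr i) ∨ ∑ i, s (Sum.inr i) = ∑ i, s' (Sum.inr i) ∧
    (∑ i, s (Sum.inl i) < ∑ i, s' (Sum.inl i) ∨ ∑ i, s (Sum.inl i) = ∑ i, s' (Sum.inl i) ∧
      t.toSyn s < t.toSyn s')) ↔ _
  tauto

/-- The initial term `in_<(P) ∈ ℂ[x, ξ]` of `P ∈ D` with respect to a term order. -/
def initialTerm {m : ℕ} (o : MonomialOrder (Vars m)) (P : WeylAlgebra m) :
    MvPolynomial (Vars m) ℂ :=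
  o.leadingTerm (symbol m P)

/-- `G` is a Gröbner basis of the left ideal `I` of `D`: it is a finite subset of `D` that
generates `I`, and the initial terms of its elements generate the ideal of `ℂ[x, ξ]` generated by
the initial terms of all elements of `I`. (`Ideal` means left ideal.) -/
def IsGroebnerBasis {m : ℕ} (o : MonomialOrder (Vars m)) (G : Set (WeylAlgebra m))
    (I : Ideal (WeylAlgebra m)) : Prop :=
  G.Finite ∧ Ideal.span G = I ∧
    Ideal.span (initialTerm o '' G) = Ideal.span (initialTerm o '' (I : Set (WeylAlgebra m)))

/-- The `(0,1)`-initial form of `P = ∑ c_{αβ} x^α ∂^β`: the sum of the terms `c_{αβ} x^α ξ^β`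
of the highest weight, where `x_i` has weight `0` and `ξ_i` has weight `1`. -/
def initialForm {m : ℕ} (P : WeylAlgebra m) : MvPolynomial (Vars m) ℂ :=
  let w : Vars m → ℕ := Sum.elim (fun _ => 0) (fun _ => 1)
  MvPolynomial.weightedHomogeneousComponent w
    (MvPolynomial.weightedTotalDegree w (symbol m P)) (symbol m P)

/-! ### Lauricella's operators

The formulas are written for arbitrary elements `x_i`, `∂_i` of a `ℂ`-algebra, with
`θ_i = x_i ∂_i`; they are used in the Weyl algebra and in the algebra of operators on Laurent
polynomials. -/

section Operators

variable {m : ℕ} {A : Type*} [Ring A] [Algebra ℂ A]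

/-- The Euler operator `θ_i = x_i ∂_i`. -/
def euler (x d : Fin m → A) (i : Fin m) : A := x i * d i

/-- `ℓ_i^A = θ_i (θ_i + c_i - 1) - x_i (θ_1 + ⋯ + θ_m + a) (θ_i + b_i)`. -/
def ellA (x d : Fin m → A) (a : ℂ) (b c : Fin m → ℂ) (i : Fin m) : A :=
  euler x d i * (euler x d i + algebraMap ℂ A (c i - 1)) -
    x i * (∑ j, euler x d j + algebraMap ℂ A a) * (euler x d i + algebraMap ℂ A (b i))

/-- `ℓ_i^B = θ_i (θ_1 + ⋯ + θ_m + c - 1) - x_i (θ_i + a_i) (θ_i + b_i)`. -/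
def ellB (x d : Fin m → A) (a b : Fin m → ℂ) (c : ℂ) (i : Fin m) : A :=
  euler x d i * (∑ j, euler x d j + algebraMap ℂ A (c - 1)) -
    x i * (euler x d i + algebraMap ℂ A (a i)) * (euler x d i + algebraMap ℂ A (b i))

/-- `p_i^A = X_i θ_i (-θ_i + c_i - 1) + (θ_1 + ⋯ + θ_m - a) (θ_i - b_i)`. -/
def pA (x d : Fin m → A) (a : ℂ) (b c : Fin m → ℂ) (i : Fin m) : A :=
  x i * euler x d i * (-euler x d i + algebraMap ℂ A (c i - 1)) +
    (∑ j, euler x d j - algebraMap ℂ A a) * (euler x d i - algebraMap ℂ A (b i))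

end Operators

/-! ### The coordinate change `X_i = 1 / x_i` on the torus -/

/-- Laurent polynomials in `m` variables: the regular functions on the torus `(ℂ^*)^m`. -/
abbrev Laurent (m : ℕ) := AddMonoidAlgebra ℂ (Fin m → ℤ)

/-- Multiplication by the `i`-th coordinate, as an operator on Laurent polynomials. -/
def laurentX {m : ℕ} (i : Fin m) : Module.End ℂ (Laurent m) :=
  LinearMap.mulLeft ℂ (AddMonoidAlgebra.single (Pi.single i 1) 1)

/-- The partial derivative with respect to the `i`-th coordinate on Laurent polynomials:
`x^n ↦ n_i x^{n - e_i}`. -/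
def laurentD {m : ℕ} (i : Fin m) : Module.End ℂ (Laurent m) :=
  (AddMonoidAlgebra.basis (Fin m → ℤ) ℂ).constr ℂ fun n =>
    AddMonoidAlgebra.single (n - Pi.single i 1) (n i : ℂ)

/-- The substitution `x_i ↦ 1 / x_i` for all `i`, i.e. `x^n ↦ x^{-n}`, on Laurent polynomials. -/
def laurentInv (m : ℕ) : Laurent m ≃ₐ[ℂ] Laurent m :=
  AddMonoidAlgebra.domCongr ℂ ℂ (AddEquiv.neg (Fin m → ℤ))

/-- The operator that `P` becomes after the coordinate change `X_i = 1 / x_i`. -/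
def invertCoordinates {m : ℕ} (P : Module.End ℂ (Laurent m)) : Module.End ℂ (Laurent m) :=
  (laurentInv m).toLinearEquiv.conj P

end Lauricella

end

/-!
Give the operator `p_i^A` its parameter `a` as a superscript. The Euler operators commute and each
`X_i` raises `∑ θ_j` by one, so `p_j^(a+1) p_i^(a) = p_i^(a+1) p_j^(a)`. Both `p_i^(a)` and
`p_i^(a+1)` have leading term `-X_i³ ξ_i²`, and these monomials are pairwise coprime. Leading terms
multiply in the Weyl algebra, hence in `Q p_k + R`, with `R` in the left ideal of the other
generators, `Q` can be reduced modulo the left ideal `{B | B p_k ∈ ⟨p_i : i ≠ k⟩}`. The latter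
contains `p_i^(a+1)`, so coprimality keeps the leading terms of `Q p_k` and `R` from cancelling, and
induction on the number of generators gives the Gröbner basis property.

The coordinate change conjugates operators by `X ↦ X⁻¹`, which sends `θ_i` to `-θ_i`. The operators
`p_i^A` and `ℓ_i^B` share their part of order two, `X_i ξ_i (∑ X_j ξ_j - X_i² ξ_i)`.
-/

noncomputable section

namespace Lauricella

section LeadingTerm

open MvPolynomial

variable {σ : Type*} {o : MonomialOrder σ}

theorem leadingTerm_add_of_mem_restrictSupport {R : Type*} [CommSemiring R]
    {f g : MvPolynomial σ R} (hg : g ∈ restrictSupport R {u | u ≺[o] o.degree f}) :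
    o.leadingTerm (f + g) = o.leadingTerm f := by
  rcases eq_or_ne g 0 with rfl | hg0
  · rw [add_zero]
  · have hlt : o.degree g ≺[o] o.degree f :=
      (mem_restrictSupport_iff R).mp hg (o.degree_mem_support hg0)
    rw [MonomialOrder.leadingTerm, MonomialOrder.leadingTerm, o.degree_add_of_lt hlt,
      o.leadingCoeff_add_of_lt hlt]

theorem degree_sub_lt_of_leadingTerm_eq {R : Type*} [CommRing R] {f g : MvPolynomial σ R}
    (h : o.leadingTerm f = o.leadingTerm g) (hne : f - g ≠ 0) :
    o.degree (f - g) ≺[o] o.degree f := by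
  obtain ⟨hcoeff, hdeg⟩ := o.leadingTerm_eq_leadingTerm_iff.mp h
  have hle : o.degree (f - g) ≼[o] o.degree f := by
    simpa only [hdeg, sup_idem] using o.degree_sub_le (f := f) (g := g)
  refine lt_of_le_of_ne hle fun heq => hne ?_
  rw [← o.coeff_degree_eq_zero_iff, o.toSyn.injective heq, coeff_sub, sub_eq_zero]
  nth_rw 2 [hdeg]
  exact hcoeff

theorem degree_add_eq_or_eq_of_ne {R : Type*} [CommSemiring R] {f g : MvPolynomial σ R}
    (h : o.degree f ≠ o.degree g) :
    o.degree (f + g) = o.degree f ∨ o.degree (f + g) = o.degree g :=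
  (max_choice (o.toSyn (o.degree f)) (o.toSyn (o.degree g))).imp
    (fun hmax => o.toSyn.injective ((o.degree_add_of_ne h).trans hmax))
    (fun hmax => o.toSyn.injective ((o.degree_add_of_ne h).trans hmax))

theorem leadingTerm_dvd_leadingTerm_of_degree_le {K : Type*} [Field K] {f g : MvPolynomial σ K}
    (hg : g ≠ 0) (h : o.degree g ≤ o.degree f) : o.leadingTerm g ∣ o.leadingTerm f := by
  refine monomial_dvd_monomial.mpr ⟨Or.inr h, ?_⟩
  exact (isUnit_iff_ne_zero.mpr (o.leadingCoeff_ne_zero_iff.mpr hg)).dvd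

end LeadingTerm

theorem le_left_of_le_add_of_disjoint {σ : Type*} {u v w : σ →₀ ℕ} (huw : Disjoint u w)
    (h : u ≤ v + w) : u ≤ v := by
  intro k
  have hk := Finsupp.le_def.mp h k
  have hmin : min (u k) (w k) = 0 := DFunLike.congr_fun (disjoint_iff.mp huw) k
  rw [Finsupp.add_apply] at hk
  omega

section Criterion

variable {K A σ ι : Type*} [Field K] [Ring A] {o : MonomialOrder σ}
  {φ : A ≃+ MvPolynomial σ K}

theorem leadingTerm_apply_eq_zero_iff {P : A} : o.leadingTerm (φ P) = 0 ↔ P = 0 := by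
  rw [o.leadingTerm_eq_zero_iff, EmbeddingLike.map_eq_zero_iff]

theorem exists_leadingTerm_mul_eq
    (hφ : ∀ P Q, o.leadingTerm (φ (P * Q)) = o.leadingTerm (φ P) * o.leadingTerm (φ Q))
    {P Q : A} (hP : P ≠ 0) (h : o.degree (φ P) ≤ o.degree (φ Q)) :
    ∃ B, o.leadingTerm (φ (B * P)) = o.leadingTerm (φ Q) := by
  have hP' : φ P ≠ 0 := (map_ne_zero_iff φ φ.injective).mpr hP
  obtain ⟨r, hr⟩ := leadingTerm_dvd_leadingTerm_of_degree_le hP' h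
  refine ⟨φ.symm (o.leadingTerm r), ?_⟩
  rw [hφ, AddEquiv.apply_symm_apply, o.leadingTerm_leadingTerm]
  have hr' := congrArg o.leadingTerm hr
  rw [o.leadingTerm_leadingTerm, o.leadingTerm_mul, o.leadingTerm_leadingTerm] at hr'
  rw [hr', mul_comm]

theorem exists_reduced_sub_mem
    (hφ : ∀ P Q, o.leadingTerm (φ (P * Q)) = o.leadingTerm (φ P) * o.leadingTerm (φ Q))
    (J : Ideal A) (Q : A) :
    ∃ Q', Q - Q' ∈ J ∧
      (Q' ≠ 0 → ∀ P ∈ J, P ≠ 0 → ¬o.degree (φ P) ≤ o.degree (φ Q')) := by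
  induction hd : o.toSyn (o.degree (φ Q)) using WellFoundedLT.induction generalizing Q with
  | ind d ih =>
    by_cases hred : ∀ P ∈ J, P ≠ 0 → ¬o.degree (φ P) ≤ o.degree (φ Q)
    · exact ⟨Q, by rw [sub_self]; exact J.zero_mem, fun _ => hred⟩
    · push Not at hred
      obtain ⟨P, hPJ, hP0, hPQ⟩ := hred
      obtain ⟨B, hB⟩ := exists_leadingTerm_mul_eq hφ hP0 hPQ
      have hBP : B * P ∈ J := J.mul_mem_left B hPJ
      rcases eq_or_ne (Q - B * P) 0 with h0 | h0
      · exact ⟨0, by rwa [sub_zero, sub_eq_zero.mp h0], fun h => absurd rfl h⟩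
      · have hlt : o.degree (φ (Q - B * P)) ≺[o] o.degree (φ Q) := by
          rw [map_sub]
          refine degree_sub_lt_of_leadingTerm_eq hB.symm ?_
          rwa [← map_sub, map_ne_zero_iff φ φ.injective]
        obtain ⟨Q', hQ', hred'⟩ := ih _ (hd ▸ hlt) _ rfl
        refine ⟨Q', ?_, hred'⟩
        have := J.add_mem hQ' hBP
        rwa [sub_right_comm, sub_add_cancel] at this

theorem exists_eq_mul_add_of_mem_span_insert
    (hφ : ∀ P Q, o.leadingTerm (φ (P * Q)) = o.leadingTerm (φ P) * o.leadingTerm (φ Q))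
    {p P : A} {G : Set A} (hP : P ∈ Ideal.span (insert p G)) :
    ∃ Q, ∃ R ∈ Ideal.span G, P = Q * p + R ∧
      (Q ≠ 0 → ∀ B, B * p ∈ Ideal.span G → B ≠ 0 → ¬o.degree (φ B) ≤ o.degree (φ Q)) := by
  obtain ⟨Q, R, hR, rfl⟩ := Ideal.mem_span_insert.mp hP
  obtain ⟨Q', hQ', hred⟩ := exists_reduced_sub_mem hφ
    (Submodule.comap (LinearMap.toSpanSingleton A A p) (Ideal.span G)) Q
  refine ⟨Q', (Q - Q') * p + R, add_mem hQ' hR, ?_, hred⟩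
  rw [← add_assoc, ← add_mul, add_sub_cancel]

theorem degree_mul_of_leadingTerm_mul
    (hφ : ∀ P Q, o.leadingTerm (φ (P * Q)) = o.leadingTerm (φ P) * o.leadingTerm (φ Q))
    {P Q : A} (hP : P ≠ 0) (hQ : Q ≠ 0) :
    o.degree (φ (P * Q)) = o.degree (φ P) + o.degree (φ Q) := by
  have hne {B : A} (hB : B ≠ 0) : o.leadingTerm (φ B) ≠ 0 :=
    leadingTerm_apply_eq_zero_iff.not.mpr hB
  rw [← o.degree_leadingTerm, hφ, o.degree_mul (hne hP) (hne hQ), o.degree_leadingTerm,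
    o.degree_leadingTerm]

theorem exists_degree_le_of_mem_span_image
    (hφ : ∀ P Q, o.leadingTerm (φ (P * Q)) = o.leadingTerm (φ P) * o.leadingTerm (φ Q))
    {p q : ι → A} (hp : ∀ i, p i ≠ 0)
    (hdisj : Pairwise fun i j => Disjoint (o.degree (φ (p i))) (o.degree (φ (p j))))
    (hq : ∀ i, o.leadingTerm (φ (q i)) = o.leadingTerm (φ (p i)))
    (hqp : ∀ i j, q j * p i = q i * p j) (S : Finset ι) {P : A} (hP : P ∈ Ideal.span (p '' S))
    (hP0 : P ≠ 0) : ∃ i ∈ S, o.degree (φ (p i)) ≤ o.degree (φ P) := by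
  classical
  induction S using Finset.induction generalizing P with
  | empty => exact absurd (by simpa using hP) hP0
  | insert k S hk ih =>
    rw [Finset.coe_insert, Set.image_insert_eq] at hP
    obtain ⟨Q, R, hR, rfl, hred⟩ := exists_eq_mul_add_of_mem_span_insert hφ hP
    have ih_insert {R : A} (hR : R ∈ Ideal.span (p '' S)) (hR0 : R ≠ 0) :
        ∃ i ∈ insert k S, o.degree (φ (p i)) ≤ o.degree (φ R) :=
      (ih hR hR0).imp fun i hi => ⟨Finset.mem_insert_of_mem hi.1, hi.2⟩
    rcases eq_or_ne Q 0 with rfl | hQ0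
    · rw [zero_mul, zero_add] at hP0 ⊢
      exact ih_insert hR hP0
    have hQp := degree_mul_of_leadingTerm_mul hφ hQ0 (hp k)
    have hk_le : ∃ i ∈ insert k S, o.degree (φ (p i)) ≤ o.degree (φ (Q * p k)) :=
      ⟨k, Finset.mem_insert_self k S, hQp ▸ le_add_self⟩
    rcases eq_or_ne R 0 with rfl | hR0
    · rwa [add_zero]
    have hne : o.degree (φ (Q * p k)) ≠ o.degree (φ R) := by
      intro heq
      obtain ⟨i, hi, hle⟩ := ih hR hR0
      rw [← heq, hQp] at hle
      have hqi : q i ≠ 0 := by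
        rw [ne_eq, ← leadingTerm_apply_eq_zero_iff (o := o) (φ := φ), hq,
          leadingTerm_apply_eq_zero_iff]
        exact hp i
      -- `q i * p k = q k * p i` puts `q i` in the colon ideal modulo which `Q` is reduced.
      refine hred hQ0 (q i) (hqp k i ▸ Ideal.mul_mem_left _ _ (Ideal.subset_span ⟨i, hi, rfl⟩))
        hqi ?_
      rw [(o.leadingTerm_eq_leadingTerm_iff.mp (hq i)).2]
      exact le_left_of_le_add_of_disjoint (hdisj (ne_of_mem_of_not_mem hi hk)) hle
    rw [map_add]
    rcases degree_add_eq_or_eq_of_ne hne with h | h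
    · rwa [h]
    · rw [h]
      exact ih_insert hR hR0

end Criterion

section RestrictSupport

open MvPolynomial
open scoped Pointwise

variable {σ R : Type*} [CommSemiring R]

theorem mul_mem_restrictSupport {S T U : Set (σ →₀ ℕ)} (h : S + T ⊆ U) {f g : MvPolynomial σ R}
    (hf : f ∈ restrictSupport R S) (hg : g ∈ restrictSupport R T) :
    f * g ∈ restrictSupport R U :=
  restrictSupport_mono R h (restrictSupport_add R S T ▸ Submodule.mul_mem_mul hf hg)

theorem pderiv_mem_restrictSupport {S : Set (σ →₀ ℕ)} (hS : IsLowerSet S) (v : σ)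
    {f : MvPolynomial σ R} (hf : f ∈ restrictSupport R S) : pderiv v f ∈ restrictSupport R S := by
  rw [restrictSupport_eq_span] at hf
  induction hf using Submodule.span_induction with
  | mem _ h =>
    obtain ⟨s, hs, rfl⟩ := h
    rw [pderiv_monomial, monomial_mem_restrictSupport]
    exact Or.inl (hS tsub_le_self hs)
  | zero => rw [map_zero]; exact zero_mem _
  | add f g _ _ hf hg => rw [map_add]; exact add_mem hf hg
  | smul r f _ hf => rw [Derivation.map_smul]; exact Submodule.smul_mem _ r hf

variable {o : MonomialOrder σ}

theorem isLowerSet_setOf_le (o : MonomialOrder σ) (e : σ →₀ ℕ) : IsLowerSet {u | u ≼[o] e} :=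
  fun _ _ hle hu => (o.toSyn_monotone hle).trans hu

theorem restrictSupport_le_le_lt_single_add (v : σ) (e : σ →₀ ℕ) :
    restrictSupport R {u | u ≼[o] e} ≤ restrictSupport R {u | u ≺[o] Finsupp.single v 1 + e} := by
  have hpos : 0 < Finsupp.single v 1 := by simp [pos_iff_ne_zero]
  exact restrictSupport_mono R fun _ hu =>
    (Set.mem_ofPred.mp hu).trans_lt (o.toSyn_strictMono (lt_add_of_pos_left e hpos))

theorem X_mem_restrictSupport_le (v : σ) :
    (X v : MvPolynomial σ R) ∈ restrictSupport R {u | u ≼[o] Finsupp.single v 1} :=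
  (monomial_mem_restrictSupport R).mpr (Or.inl le_rfl)

theorem mul_mem_restrictSupport_le {e e' : σ →₀ ℕ} {f g : MvPolynomial σ R}
    (hf : f ∈ restrictSupport R {u | u ≼[o] e}) (hg : g ∈ restrictSupport R {u | u ≼[o] e'}) :
    f * g ∈ restrictSupport R {u | u ≼[o] e + e'} := by
  refine mul_mem_restrictSupport ?_ hf hg
  rintro _ ⟨u, hu, u', hu', rfl⟩
  simpa only [Set.mem_ofPred, map_add] using add_le_add hu hu'

theorem mul_mem_restrictSupport_lt {e e' : σ →₀ ℕ} {f g : MvPolynomial σ R}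
    (hf : f ∈ restrictSupport R {u | u ≼[o] e}) (hg : g ∈ restrictSupport R {u | u ≺[o] e'}) :
    f * g ∈ restrictSupport R {u | u ≺[o] e + e'} := by
  refine mul_mem_restrictSupport ?_ hf hg
  rintro _ ⟨u, hu, u', hu', rfl⟩
  simpa only [Set.mem_ofPred, map_add] using add_lt_add_of_le_of_lt hu hu'

theorem mem_restrictSupport_degree_le (o : MonomialOrder σ) (f : MvPolynomial σ R) :
    f ∈ restrictSupport R {u | u ≼[o] o.degree f} :=
  (mem_restrictSupport_iff R).mpr fun _ => o.le_degree

end RestrictSupport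

section Symbol

open MvPolynomial

variable {m : ℕ}

theorem symbol_normalOrder (f : MvPolynomial (Vars m) ℂ) : symbol m (normalOrder m f) = f :=
  LinearEquiv.ofBijective_symm_apply_apply _ f

theorem normalOrder_symbol (P : WeylAlgebra m) : normalOrder m (symbol m P) = P :=
  (symbol m).symm_apply_apply P

theorem normalOrder_one : normalOrder m 1 = 1 := by
  rw [← C_1, C_apply, normalOrder_monomial, one_smul, xExp, xiExp, map_zero, Prod.fst_zero,
    Prod.snd_zero, xPow_zero, dPow_zero, one_mul]

theorem xExp_single_inl (i : Fin m) (n : ℕ) :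
    xExp (Finsupp.single (Sum.inl i) n) = Finsupp.single i n := by
  ext j
  simp [xExp, Finsupp.single_apply]

theorem xiExp_single_inl (i : Fin m) (n : ℕ) : xiExp (Finsupp.single (Sum.inl i) n) = 0 := by
  ext j
  simp [xiExp]

theorem xExp_single_inr (i : Fin m) (n : ℕ) : xExp (Finsupp.single (Sum.inr i) n) = 0 := by
  ext j
  simp [xExp]

theorem xiExp_single_inr (i : Fin m) (n : ℕ) :
    xiExp (Finsupp.single (Sum.inr i) n) = Finsupp.single i n := by
  ext j
  simp [xiExp, Finsupp.single_apply]

theorem normalOrder_X_inl_mul (i : Fin m) (f : MvPolynomial (Vars m) ℂ) :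
    normalOrder m (X (Sum.inl i) * f) = x i * normalOrder m f := by
  induction f using MvPolynomial.induction_on' with
  | add f g hf hg => rw [mul_add, map_add, hf, hg, map_add, mul_add]
  | monomial s c =>
    rw [X, monomial_mul, one_mul, normalOrder_monomial, normalOrder_monomial, xExp_add, xiExp_add,
      xExp_single_inl, xiExp_single_inl, zero_add, xPow_add, xPow_single, mul_assoc,
      mul_smul_comm]

theorem normalOrder_mul_X_inr (i : Fin m) (f : MvPolynomial (Vars m) ℂ) :
    normalOrder m (f * X (Sum.inr i)) = normalOrder m f * d i := by
  induction f using MvPolynomial.induction_on' with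
  | add f g hf hg => rw [add_mul, map_add, hf, hg, map_add, add_mul]
  | monomial s c =>
    rw [X, monomial_mul, mul_one, normalOrder_monomial, normalOrder_monomial, xExp_add, xiExp_add,
      xExp_single_inr, xiExp_single_inr, add_zero, dPow_add, dPow_single, smul_mul_assoc,
      mul_assoc]

theorem d_mul_normalOrder (i : Fin m) (f : MvPolynomial (Vars m) ℂ) :
    d i * normalOrder m f =
      normalOrder m (X (Sum.inr i) * f + pderiv (Sum.inl i) f) := by
  induction f using MvPolynomial.induction_on' with
  | add f g hf hg =>
    rw [map_add, mul_add, hf, hg, ← map_add, map_add (pderiv _), mul_add, add_add_add_comm]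
  | monomial s c =>
    have hx : xExp (s - Finsupp.single (Sum.inl i) 1) = xExp s - Finsupp.single i 1 := by
      ext j
      simp [xExp, Finsupp.single_apply]
    have hxi : xiExp (s - Finsupp.single (Sum.inl i) 1) = xiExp s := by
      ext j
      simp [xiExp]
    have hs : xExp s i = s (Sum.inl i) := rfl
    rw [pderiv_monomial, map_add, mul_comm (X _), normalOrder_mul_X_inr, normalOrder_monomial,
      normalOrder_monomial, hx, hxi, mul_smul_comm, ← mul_assoc, d_mul_xPow, hs]
    simp only [add_mul, smul_add, smul_mul_assoc, mul_assoc, smul_smul]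
    rw [← dPow_single, ← dPow_add, ← dPow_add, add_comm (xiExp s)]

theorem symbol_x_mul (i : Fin m) (P : WeylAlgebra m) :
    symbol m (x i * P) = X (Sum.inl i) * symbol m P := by
  rw [← (normalOrder_injective m).eq_iff, normalOrder_symbol, normalOrder_X_inl_mul,
    normalOrder_symbol]

theorem symbol_d_mul (i : Fin m) (P : WeylAlgebra m) :
    symbol m (d i * P) = X (Sum.inr i) * symbol m P + pderiv (Sum.inl i) (symbol m P) := by
  rw [← (normalOrder_injective m).eq_iff, normalOrder_symbol, ← d_mul_normalOrder,
    normalOrder_symbol]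

end Symbol

section InitialTermMul

open MvPolynomial

variable {m : ℕ} {o : MonomialOrder (Vars m)}

theorem symbol_d_mul_mem_restrictSupport_le {P : WeylAlgebra m} {e : Vars m →₀ ℕ}
    (hP : symbol m P ∈ restrictSupport ℂ {u | u ≼[o] e}) (i : Fin m) :
    symbol m (d i * P) ∈ restrictSupport ℂ {u | u ≼[o] Finsupp.single (Sum.inr i) 1 + e} := by
  rw [symbol_d_mul]
  refine add_mem (mul_mem_restrictSupport_le (X_mem_restrictSupport_le _) hP) ?_
  refine restrictSupport_mono ℂ (fun u hu => ?_)
    (pderiv_mem_restrictSupport (isLowerSet_setOf_le o e) (Sum.inl i) hP)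
  exact (Set.mem_ofPred.mp hu).trans (o.toSyn_monotone le_add_self)

theorem symbol_normalOrder_monomial_mul_sub_mem (s : Vars m →₀ ℕ) {e : Vars m →₀ ℕ}
    {P : WeylAlgebra m} (hP : symbol m P ∈ restrictSupport ℂ {u | u ≼[o] e}) :
    symbol m (normalOrder m (monomial s 1) * P) - monomial s 1 * symbol m P ∈
      restrictSupport ℂ {u | u ≺[o] s + e} := by
  obtain ⟨M, rfl⟩ := Multiset.toFinsupp.surjective s
  induction M using Multiset.induction generalizing P e with
  | empty =>
    rw [Multiset.toFinsupp_zero, ← C_apply, C_1, normalOrder_one, one_mul, one_mul, sub_self]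
    exact zero_mem _
  | cons v M ih =>
    set s := Multiset.toFinsupp M
    have hs : Multiset.toFinsupp (v ::ₘ M) = Finsupp.single v 1 + s := by
      rw [← Multiset.singleton_add, Multiset.toFinsupp_add, Multiset.toFinsupp_singleton]
    have hX : monomial (Finsupp.single v 1 + s) (1 : ℂ) = X v * monomial s 1 := by
      rw [X, monomial_mul, one_mul]
    rw [hs, hX, add_assoc]
    rcases v with i | i
    · rw [normalOrder_X_inl_mul, mul_assoc, symbol_x_mul, mul_assoc, ← mul_sub]
      exact mul_mem_restrictSupport_lt (X_mem_restrictSupport_le _) (ih hP)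
    · have hd := ih (symbol_d_mul_mem_restrictSupport_le hP i)
      have hpd : monomial s 1 * pderiv (Sum.inl i) (symbol m P) ∈
          restrictSupport ℂ {u | u ≼[o] s + e} :=
        mul_mem_restrictSupport_le
          ((monomial_mem_restrictSupport ℂ).mpr (Or.inl (Set.mem_ofPred.mpr le_rfl)))
          (pderiv_mem_restrictSupport (isLowerSet_setOf_le o e) _ hP)
      rw [symbol_d_mul, add_left_comm] at hd
      rw [mul_comm (X _), normalOrder_mul_X_inr, mul_assoc]
      convert add_mem hd (restrictSupport_le_le_lt_single_add _ _ hpd) using 1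
      ring

theorem symbol_normalOrder_mul_sub_mem {e e' : Vars m →₀ ℕ} {f : MvPolynomial (Vars m) ℂ}
    {P : WeylAlgebra m} (hf : f ∈ restrictSupport ℂ {u | u ≼[o] e})
    (hP : symbol m P ∈ restrictSupport ℂ {u | u ≼[o] e'}) :
    symbol m (normalOrder m f * P) - f * symbol m P ∈ restrictSupport ℂ {u | u ≺[o] e + e'} := by
  rw [restrictSupport_eq_span] at hf
  induction hf using Submodule.span_induction with
  | mem _ h =>
    obtain ⟨s, hs, rfl⟩ := h
    refine restrictSupport_mono ℂ (fun u hu => ?_) (symbol_normalOrder_monomial_mul_sub_mem s hP)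
    have hle : s + e' ≼[o] e + e' := by
      simpa only [map_add] using add_le_add_left (Set.mem_ofPred.mp hs) (o.toSyn e')
    exact (Set.mem_ofPred.mp hu).trans_le hle
  | zero => simp
  | add f g _ _ hf hg =>
    rw [map_add (normalOrder m), add_mul, map_add (symbol m), add_mul, add_sub_add_comm]
    exact add_mem hf hg
  | smul z f _ hf =>
    rw [map_smul, smul_mul_assoc, map_smul, smul_mul_assoc, ← smul_sub]
    exact Submodule.smul_mem _ z hf

theorem initialTerm_mul (P Q : WeylAlgebra m) :
    initialTerm o (P * Q) = initialTerm o P * initialTerm o Q := by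
  rcases eq_or_ne P 0 with rfl | hP
  · simp [initialTerm]
  rcases eq_or_ne Q 0 with rfl | hQ
  · simp [initialTerm]
  have hmem := symbol_normalOrder_mul_sub_mem (mem_restrictSupport_degree_le o (symbol m P))
    (mem_restrictSupport_degree_le o (symbol m Q))
  have hne : ∀ {B : WeylAlgebra m}, B ≠ 0 → symbol m B ≠ 0 :=
    (map_ne_zero_iff _ (symbol m).injective).mpr
  rw [normalOrder_symbol, ← o.degree_mul (hne hP) (hne hQ)] at hmem
  simpa only [initialTerm, add_sub_cancel, o.leadingTerm_mul] using
    leadingTerm_add_of_mem_restrictSupport hmem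

end InitialTermMul

section Commutation

variable {m : ℕ} {A : Type*} [Ring A] {x d : Fin m → A}

/-- The defining relations of the Weyl algebra, for elements `x_i`, `∂_i` of an arbitrary ring. -/
structure WeylRelations (x d : Fin m → A) : Prop where
  commute_x : ∀ i j, Commute (x i) (x j)
  commute_d : ∀ i j, Commute (d i) (d j)
  commute_d_x : ∀ i j, i ≠ j → Commute (d i) (x j)
  d_mul_x : ∀ i, d i * x i = x i * d i + 1

theorem weylRelations_x_d : WeylRelations (A := WeylAlgebra m) Lauricella.x Lauricella.d where
  commute_x := x_comm
  commute_d := d_comm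
  commute_d_x i j hij := by
    have h := d_mul_xPow i (Finsupp.single j 1)
    rwa [xPow_single, Finsupp.single_eq_of_ne hij, Nat.cast_zero, zero_smul, add_zero] at h
  d_mul_x i := by
    have h := d_mul_xPow i (Finsupp.single i 1)
    rwa [xPow_single, Finsupp.single_eq_same, Nat.cast_one, one_smul, tsub_self, xPow_zero] at h

namespace WeylRelations

variable (h : WeylRelations x d)

include h

theorem commute_euler_x {i j : Fin m} (hij : i ≠ j) : Commute (euler x d i) (x j) :=
  (h.commute_x i j).mul_left (h.commute_d_x i j hij)

theorem euler_mul_x (i : Fin m) : euler x d i * x i = x i * (euler x d i + 1) := by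
  rw [euler, mul_assoc, h.d_mul_x]

theorem commute_euler (i j : Fin m) : Commute (euler x d i) (euler x d j) := by
  rcases eq_or_ne i j with rfl | hij
  · exact Commute.refl _
  · exact (h.commute_euler_x hij).mul_right
      ((h.commute_d_x j i hij.symm).symm.mul_left (h.commute_d i j))

theorem commute_sum_euler (i : Fin m) : Commute (∑ j, euler x d j) (euler x d i) :=
  Commute.sum_left _ _ _ fun j _ => h.commute_euler j i

theorem sum_euler_mul_x (i : Fin m) :
    (∑ j, euler x d j) * x i = x i * (∑ j, euler x d j + 1) := by
  have hcomm : Commute (∑ j ∈ Finset.univ.erase i, euler x d j) (x i) :=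
    Commute.sum_left _ _ _ fun j hj => h.commute_euler_x (Finset.ne_of_mem_erase hj)
  rw [← Finset.sum_erase_add _ _ (Finset.mem_univ i), add_mul, hcomm.eq, h.euler_mul_x, ← mul_add,
    add_assoc]

end WeylRelations

theorem add_mul_mul_add_mul_comm {L L' U V U' V' : A} (hU : Commute U U') (hV : Commute V V')
    (hVU : Commute V U') (hVU' : Commute V' U) (hVL : Commute V L) (hVL' : Commute V' L)
    (hLU : L' * U = U * L) (hLU' : L' * U' = U' * L) :
    (U' + L' * V') * (U + L * V) = (U + L' * V) * (U' + L * V') := by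
  have hcross : L' * V' * U = U * (L * V') := by
    rw [mul_assoc, hVU'.eq, ← mul_assoc, hLU, mul_assoc]
  have hcross' : L' * V * U' = U' * (L * V) := by
    rw [mul_assoc, hVU.eq, ← mul_assoc, hLU', mul_assoc]
  have hlast : L' * V' * (L * V) = L' * V * (L * V') := by
    rw [mul_assoc, mul_assoc, ← mul_assoc V', ← mul_assoc V, hVL.eq, hVL'.eq, mul_assoc, mul_assoc,
      hV.eq]
  simp only [add_mul, mul_add, hcross, hcross', hlast, hU.eq]
  abel

variable [Algebra ℂ A]

theorem commute_euler_mul_neg_euler_add {B : A} {i : Fin m} (h : Commute B (euler x d i)) (z : ℂ) :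
    Commute B (euler x d i * (-euler x d i + algebraMap ℂ A z)) :=
  h.mul_right (h.neg_right.add_right (Algebra.commutes z B).symm)

theorem WeylRelations.sum_euler_sub_mul_x_mul (h : WeylRelations x d) {B : A}
    (hB : Commute (∑ j, euler x d j) B) (z : ℂ) (i : Fin m) :
    (∑ j, euler x d j - algebraMap ℂ A (z + 1)) * (x i * B) =
      x i * B * (∑ j, euler x d j - algebraMap ℂ A z) := by
  rw [sub_mul, ← mul_assoc, h.sum_euler_mul_x, mul_assoc, ← mul_assoc (algebraMap ℂ A _),
    Algebra.commutes, mul_assoc, ← mul_sub, ← sub_mul, map_add, map_one, add_sub_add_right_eq_sub,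
    sub_mul, hB.eq, Algebra.commutes, ← mul_sub, mul_assoc]

theorem WeylRelations.pA_add_one_mul_pA (h : WeylRelations x d) (a : ℂ) (b c : Fin m → ℂ)
    (i j : Fin m) :
    pA x d (a + 1) b c j * pA x d a b c i = pA x d (a + 1) b c i * pA x d a b c j := by
  rcases eq_or_ne i j with rfl | hij
  · rfl
  set E := ∑ k, euler x d k
  set F : Fin m → A := fun k => euler x d k * (-euler x d k + algebraMap ℂ A (c k - 1))
  set V : Fin m → A := fun k => euler x d k - algebraMap ℂ A (b k)
  have hpA (z : ℂ) (k : Fin m) : pA x d z b c k = x k * F k + (E - algebraMap ℂ A z) * V k := by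
    rw [pA, mul_assoc]
  have hFx {k l : Fin m} (hkl : k ≠ l) : Commute (F k) (x l) :=
    (commute_euler_mul_neg_euler_add (h.commute_euler_x hkl).symm _).symm
  have hVF (k l : Fin m) : Commute (V k) (F l) :=
    commute_euler_mul_neg_euler_add ((h.commute_euler k l).sub_left (Algebra.commutes _ _)) _
  have hVxF {k l : Fin m} (hkl : k ≠ l) : Commute (V k) (x l * F l) :=
    ((h.commute_euler_x hkl).sub_left (Algebra.commutes _ _)).mul_right (hVF k l)
  have hxF : Commute (x i * F i) (x j * F j) :=
    ((h.commute_x i j).mul_left (hFx hij)).mul_right <| (hFx hij.symm).symm.mul_left <|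
      commute_euler_mul_neg_euler_add
        (commute_euler_mul_neg_euler_add (h.commute_euler j i) _).symm _
  have hVE (k : Fin m) : Commute (V k) (E - algebraMap ℂ A a) :=
    ((h.commute_sum_euler k).symm.sub_left (Algebra.commutes _ _)).sub_right
      (Algebra.commutes _ _).symm
  have hVV : Commute (V i) (V j) :=
    ((h.commute_euler i j).sub_left (Algebra.commutes _ _)).sub_right (Algebra.commutes _ _).symm
  have hshift (k : Fin m) := h.sum_euler_sub_mul_x_mul
    (commute_euler_mul_neg_euler_add (h.commute_sum_euler k) (c k - 1)) a k
  simp only [hpA]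
  exact add_mul_mul_add_mul_comm hxF hVV (hVxF hij) (hVxF hij.symm) (hVE i) (hVE j)
    (hshift i) (hshift j)

end Commutation

section WeightedHomogeneous

open MvPolynomial

variable {σ R : Type*} [CommSemiring R] {w : σ → ℕ} {n : ℕ}

theorem mem_restrictSupport_weight_lt {f : MvPolynomial σ R} {k : ℕ}
    (hf : IsWeightedHomogeneous w f k) (hk : k < n) :
    f ∈ restrictSupport R {s | Finsupp.weight w s < n} :=
  (mem_restrictSupport_iff R).mpr fun _ hs => (hf (mem_support_iff.mp hs)).trans_lt hk

theorem weightedHomogeneousComponent_weightedTotalDegree_add {f g : MvPolynomial σ R}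
    (hf : IsWeightedHomogeneous w f n) (hf0 : f ≠ 0)
    (hg : g ∈ restrictSupport R {s | Finsupp.weight w s < n}) :
    weightedHomogeneousComponent w (weightedTotalDegree w (f + g)) (f + g) = f := by
  classical
  have hg_lt {s : σ →₀ ℕ} (hs : s ∈ g.support) : Finsupp.weight w s < n :=
    (mem_restrictSupport_iff R).mp hg hs
  have hdeg : weightedTotalDegree w (f + g) = n := by
    refine le_antisymm (Finset.sup_le fun s hs => ?_) ?_
    · rcases Finset.mem_union.mp (support_add hs) with h | h
      · exact (hf (mem_support_iff.mp h)).le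
      · exact (hg_lt h).le
    · obtain ⟨s, hs⟩ := support_nonempty.mpr hf0
      have hws : Finsupp.weight w s = n := hf (mem_support_iff.mp hs)
      have hgs : coeff s g = 0 := notMem_support_iff.mp fun h => (hg_lt h).ne hws
      rw [← hws]
      refine le_weightedTotalDegree w (mem_support_iff.mpr ?_)
      rwa [coeff_add, hgs, add_zero, ← mem_support_iff]
  rw [hdeg, map_add, hf.weightedHomogeneousComponent_same,
    weightedHomogeneousComponent_eq_zero' n g fun s hs => (hg_lt hs).ne, add_zero]

theorem leadingTerm_monomial_add {o : MonomialOrder σ} {s : σ →₀ ℕ} {z : R} (hz : z ≠ 0)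
    {f : MvPolynomial σ R} (hf : f ∈ restrictSupport R {u | u ≺[o] s}) :
    o.leadingTerm (monomial s z + f) = monomial s z := by
  classical
  rw [leadingTerm_add_of_mem_restrictSupport (by rwa [o.degree_monomial, if_neg hz]),
    o.leadingTerm_monomial]

end WeightedHomogeneous

section Expansion

variable {m : ℕ} {A : Type*} [Ring A] [Algebra ℂ A] {x d : Fin m → A}

theorem WeylRelations.pA_expand (h : WeylRelations x d) (a : ℂ) (b c : Fin m → ℂ) (i : Fin m) :
    pA x d a b c i =
      euler x d i * ∑ j, euler x d j + (-1 : ℂ) • (x i * (euler x d i * euler x d i)) +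
        ((c i - 1) • (x i * euler x d i) + (-b i) • ∑ j, euler x d j + (-a) • euler x d i +
          (a * b i) • 1) := by
  simp only [pA, Algebra.algebraMap_eq_smul_one, mul_add, mul_sub, sub_mul, mul_smul_comm,
    smul_mul_assoc, mul_one, one_mul, mul_neg, mul_assoc, (h.commute_sum_euler i).eq]
  module

theorem ellB_expand (a b : Fin m → ℂ) (c : ℂ) (i : Fin m) :
    ellB x d a b c i =
      euler x d i * ∑ j, euler x d j + (-1 : ℂ) • (x i * (euler x d i * euler x d i)) +
        ((c - 1) • euler x d i + (-(a i + b i)) • (x i * euler x d i) + (-(a i * b i)) • x i) := by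
  simp only [ellB, Algebra.algebraMap_eq_smul_one, mul_add, add_mul, mul_smul_comm,
    smul_mul_assoc, mul_one, mul_assoc]
  module

end Expansion

section SymbolsOfOperators

open MvPolynomial

variable {m : ℕ}

/-- The symbol `x_i ξ_i` of the Euler operator `θ_i`. -/
def eulerSymbol (i : Fin m) : MvPolynomial (Vars m) ℂ := X (Sum.inl i) * X (Sum.inr i)

theorem symbol_one : symbol m 1 = 1 := by
  rw [← normalOrder_one, symbol_normalOrder]

theorem symbol_x (i : Fin m) : symbol m (x i) = X (Sum.inl i) := by
  simpa only [mul_one, symbol_one] using symbol_x_mul i (1 : WeylAlgebra m)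

theorem symbol_euler_mul (i : Fin m) (P : WeylAlgebra m) :
    symbol m (euler x d i * P) =
      eulerSymbol i * symbol m P + X (Sum.inl i) * pderiv (Sum.inl i) (symbol m P) := by
  rw [euler, mul_assoc, symbol_x_mul, symbol_d_mul, mul_add, eulerSymbol, mul_assoc]

theorem symbol_euler (i : Fin m) : symbol m (euler x d i) = eulerSymbol i := by
  simpa only [mul_one, symbol_one, Derivation.map_one_eq_zero, mul_zero, add_zero] using
    symbol_euler_mul i (1 : WeylAlgebra m)

theorem symbol_euler_mul_euler (i j : Fin m) :
    symbol m (euler x d i * euler x d j) =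
      eulerSymbol i * eulerSymbol j + if i = j then eulerSymbol i else 0 := by
  rw [symbol_euler_mul, symbol_euler]
  congr 1
  split_ifs with h
  · subst h
    simp [eulerSymbol]
  · simp [eulerSymbol, Ne.symm h]

theorem symbol_euler_mul_sum_euler (i : Fin m) :
    symbol m (euler x d i * ∑ j, euler x d j) =
      eulerSymbol i * ∑ j, eulerSymbol j + eulerSymbol i := by
  simp only [Finset.mul_sum, map_sum, symbol_euler_mul_euler, Finset.sum_add_distrib,
    Finset.sum_ite_eq, Finset.mem_univ, if_true]

/-- The common `(0,1)`-initial form `x_i ξ_i (∑ x_j ξ_j - x_i² ξ_i)` of `p_i^A` and `ℓ_i^B`. -/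
def principalForm (i : Fin m) : MvPolynomial (Vars m) ℂ :=
  eulerSymbol i * (∑ j, eulerSymbol j - X (Sum.inl i) * eulerSymbol i)

theorem symbol_pA (a : ℂ) (b c : Fin m → ℂ) (i : Fin m) :
    symbol m (pA x d a b c i) = principalForm i +
      (C (c i - 2) * (X (Sum.inl i) * eulerSymbol i) + C (-b i) * ∑ j, eulerSymbol j +
        C (1 - a) * eulerSymbol i + C (a * b i)) := by
  rw [weylRelations_x_d.pA_expand]
  simp only [map_add, map_smul, map_sum, symbol_x_mul, symbol_euler, symbol_euler_mul_euler,
    symbol_euler_mul_sum_euler, symbol_one, if_true, principalForm, smul_eq_C_mul, map_neg,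
    map_sub, map_one]
  rw [show (C 2 : MvPolynomial (Vars m) ℂ) = 2 from map_ofNat C 2]
  ring

theorem symbol_ellB (a b : Fin m → ℂ) (c : ℂ) (i : Fin m) :
    symbol m (ellB x d a b c i) = principalForm i +
      (C c * eulerSymbol i + C (-(a i + b i + 1)) * (X (Sum.inl i) * eulerSymbol i) +
        C (-(a i * b i)) * X (Sum.inl i)) := by
  rw [ellB_expand]
  simp only [map_add, map_smul, symbol_x_mul, symbol_euler, symbol_euler_mul_euler,
    symbol_euler_mul_sum_euler, symbol_x, if_true, principalForm, smul_eq_C_mul, map_neg, map_sub,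
    map_one]
  ring

end SymbolsOfOperators

section InitialForms

open MvPolynomial

variable {m : ℕ}

/-- The weight of the `(0,1)`-initial form: `x_i` has weight `0` and `ξ_i` has weight `1`. -/
def xiWeight (m : ℕ) : Vars m → ℕ := Sum.elim (fun _ => 0) (fun _ => 1)

/-- The weight giving the degree in the `x_i`, which `<_{(0,1)}` compares second: `x_i` has weight
`1` and `ξ_i` has weight `0`. -/
def xWeight (m : ℕ) : Vars m → ℕ := Sum.elim (fun _ => 1) (fun _ => 0)

theorem weight_xiWeight (s : Vars m →₀ ℕ) : Finsupp.weight (xiWeight m) s = ∑ i, s (Sum.inr i) := by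
  simp [Finsupp.weight_eq_sum, xiWeight]

theorem weight_xWeight (s : Vars m →₀ ℕ) : Finsupp.weight (xWeight m) s = ∑ i, s (Sum.inl i) := by
  simp [Finsupp.weight_eq_sum, xWeight]

theorem isWeightedHomogeneous_xiWeight_eulerSymbol (i : Fin m) :
    IsWeightedHomogeneous (xiWeight m) (eulerSymbol i) 1 :=
  (isWeightedHomogeneous_X ℂ (xiWeight m) (Sum.inl i)).mul (isWeightedHomogeneous_X ℂ _ _)

theorem isWeightedHomogeneous_xWeight_eulerSymbol (i : Fin m) :
    IsWeightedHomogeneous (xWeight m) (eulerSymbol i) 1 :=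
  (isWeightedHomogeneous_X ℂ (xWeight m) (Sum.inl i)).mul (isWeightedHomogeneous_X ℂ _ (Sum.inr i))

theorem isWeightedHomogeneous_xiWeight_X_mul_eulerSymbol (i : Fin m) :
    IsWeightedHomogeneous (xiWeight m) (X (Sum.inl i) * eulerSymbol i) 1 :=
  (isWeightedHomogeneous_X ℂ (xiWeight m) (Sum.inl i)).mul
    (isWeightedHomogeneous_xiWeight_eulerSymbol i)

theorem isWeightedHomogeneous_xiWeight_sum_eulerSymbol :
    IsWeightedHomogeneous (xiWeight m) (∑ i, eulerSymbol i) 1 :=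
  .sum _ _ _ fun i _ => isWeightedHomogeneous_xiWeight_eulerSymbol i

theorem isWeightedHomogeneous_principalForm (i : Fin m) :
    IsWeightedHomogeneous (xiWeight m) (principalForm i) 2 :=
  (isWeightedHomogeneous_xiWeight_eulerSymbol i).mul <|
    isWeightedHomogeneous_xiWeight_sum_eulerSymbol.sub
      (isWeightedHomogeneous_xiWeight_X_mul_eulerSymbol i)

theorem principalForm_ne_zero (i : Fin m) : (principalForm i : MvPolynomial (Vars m) ℂ) ≠ 0 := by
  intro h
  have heval := congrArg (eval (Sum.elim (fun _ => 2) (Pi.single i 1))) h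
  norm_num [principalForm, eulerSymbol, Pi.single_apply] at heval

theorem exists_symbol_pA_eq_principalForm_add (a : ℂ) (b c : Fin m → ℂ) (i : Fin m) :
    ∃ r ∈ restrictSupport ℂ {s | Finsupp.weight (xiWeight m) s < 2},
      symbol m (pA x d a b c i) = principalForm i + r := by
  refine ⟨_, ?_, symbol_pA a b c i⟩
  refine add_mem (add_mem (add_mem ?_ ?_) ?_) ?_
  · exact mem_restrictSupport_weight_lt
      ((isWeightedHomogeneous_xiWeight_X_mul_eulerSymbol i).C_mul _) one_lt_two
  · exact mem_restrictSupport_weight_lt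
      (isWeightedHomogeneous_xiWeight_sum_eulerSymbol.C_mul _) one_lt_two
  · exact mem_restrictSupport_weight_lt
      ((isWeightedHomogeneous_xiWeight_eulerSymbol i).C_mul _) one_lt_two
  · exact mem_restrictSupport_weight_lt (isWeightedHomogeneous_C _ _) two_pos

theorem exists_symbol_ellB_eq_principalForm_add (a b : Fin m → ℂ) (c : ℂ) (i : Fin m) :
    ∃ r ∈ restrictSupport ℂ {s | Finsupp.weight (xiWeight m) s < 2},
      symbol m (ellB x d a b c i) = principalForm i + r := by
  refine ⟨_, ?_, symbol_ellB a b c i⟩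
  refine add_mem (add_mem ?_ ?_) ?_
  · exact mem_restrictSupport_weight_lt
      ((isWeightedHomogeneous_xiWeight_eulerSymbol i).C_mul _) one_lt_two
  · exact mem_restrictSupport_weight_lt
      ((isWeightedHomogeneous_xiWeight_X_mul_eulerSymbol i).C_mul _) one_lt_two
  · exact mem_restrictSupport_weight_lt
      ((isWeightedHomogeneous_X ℂ (xiWeight m) (Sum.inl i)).C_mul _) two_pos

theorem initialForm_eq_principalForm {P : WeylAlgebra m} {i : Fin m}
    (hP : ∃ r ∈ restrictSupport ℂ {s | Finsupp.weight (xiWeight m) s < 2},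
      symbol m P = principalForm i + r) :
    initialForm P = principalForm i := by
  obtain ⟨r, hr, hsymbol⟩ := hP
  rw [initialForm, hsymbol]
  exact weightedHomogeneousComponent_weightedTotalDegree_add (isWeightedHomogeneous_principalForm i)
    (principalForm_ne_zero i) hr

theorem initialForm_pA_eq_initialForm_ellB (a : ℂ) (b c a' b' : Fin m → ℂ) (c' : ℂ) (i : Fin m) :
    initialForm (pA x d a b c i) = initialForm (ellB x d a' b' c' i) :=
  (initialForm_eq_principalForm (exists_symbol_pA_eq_principalForm_add a b c i)).trans
    (initialForm_eq_principalForm (exists_symbol_ellB_eq_principalForm_add a' b' c' i)).symm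

end InitialForms

section InitialTerms

open MvPolynomial

variable {m : ℕ}

/-- The exponent of the leading monomial `x_i³ ξ_i²` of `p_i^A`. -/
def leadExp (i : Fin m) : Vars m →₀ ℕ :=
  Finsupp.single (Sum.inl i) 3 + Finsupp.single (Sum.inr i) 2

theorem weight_xiWeight_leadExp (i : Fin m) : Finsupp.weight (xiWeight m) (leadExp i) = 2 := by
  simp [leadExp, xiWeight, Finsupp.weight_single]

theorem weight_xWeight_leadExp (i : Fin m) : Finsupp.weight (xWeight m) (leadExp i) = 3 := by
  simp [leadExp, xWeight, Finsupp.weight_single]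

theorem disjoint_leadExp {i j : Fin m} (hij : i ≠ j) : Disjoint (leadExp i) (leadExp j) := by
  rw [Finsupp.disjoint_iff, Finset.disjoint_left]
  rintro (k | k) <;> grind [leadExp, Finsupp.add_apply]

theorem principalForm_eq_monomial_leadExp_add (i : Fin m) :
    principalForm i = monomial (leadExp i) (-1) + eulerSymbol i * ∑ j, eulerSymbol j := by
  have hmonomial : monomial (leadExp i) (-1 : ℂ) = -(X (Sum.inl i) ^ 3 * X (Sum.inr i) ^ 2) := by
    rw [X_pow_eq_monomial, X_pow_eq_monomial, monomial_mul, one_mul, leadExp, map_neg]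
  rw [hmonomial, principalForm, eulerSymbol]
  ring

theorem lt_of_weight_xiWeight_lt (t : MonomialOrder (Vars m)) {s s' : Vars m →₀ ℕ}
    (h : Finsupp.weight (xiWeight m) s < Finsupp.weight (xiWeight m) s') :
    s ≺[zeroOneOrder t] s' := by
  rw [weight_xiWeight, weight_xiWeight] at h
  exact (zeroOneOrder_lt_iff t s s').mpr (.inl h)

theorem lt_of_weight_xWeight_lt (t : MonomialOrder (Vars m)) {s s' : Vars m →₀ ℕ}
    (hxi : Finsupp.weight (xiWeight m) s = Finsupp.weight (xiWeight m) s')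
    (hx : Finsupp.weight (xWeight m) s < Finsupp.weight (xWeight m) s') :
    s ≺[zeroOneOrder t] s' := by
  rw [weight_xiWeight, weight_xiWeight] at hxi
  rw [weight_xWeight, weight_xWeight] at hx
  exact (zeroOneOrder_lt_iff t s s').mpr (.inr (.inl ⟨hxi, hx⟩))

theorem eulerSymbol_mul_sum_mem_restrictSupport_lt_leadExp (t : MonomialOrder (Vars m))
    (i : Fin m) :
    eulerSymbol i * ∑ j, eulerSymbol j ∈
      restrictSupport ℂ {s | s ≺[zeroOneOrder t] leadExp i} := by
  have hxi := (isWeightedHomogeneous_xiWeight_eulerSymbol i).mul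
    isWeightedHomogeneous_xiWeight_sum_eulerSymbol
  have hx := (isWeightedHomogeneous_xWeight_eulerSymbol i).mul <|
    .sum Finset.univ _ _ fun j _ => isWeightedHomogeneous_xWeight_eulerSymbol j
  refine (mem_restrictSupport_iff ℂ).mpr fun s hs => lt_of_weight_xWeight_lt t ?_ ?_
  · rw [hxi (mem_support_iff.mp hs), weight_xiWeight_leadExp]
  · rw [hx (mem_support_iff.mp hs), weight_xWeight_leadExp]
    norm_num

theorem initialTerm_pA (t : MonomialOrder (Vars m)) (a : ℂ) (b c : Fin m → ℂ) (i : Fin m) :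
    initialTerm (zeroOneOrder t) (pA x d a b c i) = monomial (leadExp i) (-1) := by
  obtain ⟨r, hr, hsymbol⟩ := exists_symbol_pA_eq_principalForm_add a b c i
  have hr_lt : r ∈ restrictSupport ℂ {s | s ≺[zeroOneOrder t] leadExp i} :=
    restrictSupport_mono ℂ
      (fun s hs => lt_of_weight_xiWeight_lt t (hs.trans_eq (weight_xiWeight_leadExp i).symm)) hr
  rw [initialTerm, hsymbol, principalForm_eq_monomial_leadExp_add, add_assoc]
  exact leadingTerm_monomial_add (neg_ne_zero.mpr one_ne_zero)
    (add_mem (eulerSymbol_mul_sum_mem_restrictSupport_lt_leadExp t i) hr_lt)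

theorem degree_symbol_pA (t : MonomialOrder (Vars m)) (a : ℂ) (b c : Fin m → ℂ) (i : Fin m) :
    (zeroOneOrder t).degree (symbol m (pA x d a b c i)) = leadExp i := by
  classical
  rw [← MonomialOrder.degree_leadingTerm]
  change (zeroOneOrder t).degree (initialTerm _ _) = _
  rw [initialTerm_pA, MonomialOrder.degree_monomial, if_neg (neg_ne_zero.mpr one_ne_zero)]

theorem pA_ne_zero (a : ℂ) (b c : Fin m → ℂ) (i : Fin m) :
    pA (A := WeylAlgebra m) x d a b c i ≠ 0 := by
  intro h
  apply principalForm_ne_zero i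
  rw [← initialForm_eq_principalForm (exists_symbol_pA_eq_principalForm_add a b c i), h,
    initialForm, map_zero, map_zero]

end InitialTerms

section GroebnerBasis

variable {m : ℕ} {o : MonomialOrder (Vars m)} {ι : Type*} [Finite ι] {p q : ι → WeylAlgebra m}

theorem isGroebnerBasis_range (hp : ∀ i, p i ≠ 0)
    (hdisj : Pairwise fun i j =>
      Disjoint (o.degree (symbol m (p i))) (o.degree (symbol m (p j))))
    (hq : ∀ i, initialTerm o (q i) = initialTerm o (p i))
    (hqp : ∀ i j, q j * p i = q i * p j) :
    IsGroebnerBasis o (Set.range p) (Ideal.span (Set.range p)) := by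
  have := Fintype.ofFinite ι
  refine ⟨Set.finite_range p, rfl, le_antisymm ?_ ?_⟩
  · exact Ideal.span_mono (Set.image_mono Ideal.subset_span)
  rw [Ideal.span_le]
  rintro _ ⟨P, hP, rfl⟩
  rcases eq_or_ne P 0 with rfl | hP0
  · simp [initialTerm]
  rw [← Set.image_univ, ← Finset.coe_univ] at hP
  have criterion :=
    exists_degree_le_of_mem_span_image (φ := (symbol m).toAddEquiv) (o := o) (p := p) (q := q)
  obtain ⟨i, -, hi⟩ := criterion initialTerm_mul hp hdisj hq hqp Finset.univ hP hP0
  have hpi : symbol m (p i) ≠ 0 := (map_ne_zero_iff _ (symbol m).injective).mpr (hp i)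
  exact Ideal.mem_of_dvd _ (leadingTerm_dvd_leadingTerm_of_degree_le hpi hi)
    (Ideal.subset_span (Set.mem_image_of_mem _ (Set.mem_range_self i)))

theorem isGroebnerBasis_pA (a : ℂ) (b c : Fin m → ℂ) (t : MonomialOrder (Vars m)) :
    IsGroebnerBasis (zeroOneOrder t) (Set.range (pA (A := WeylAlgebra m) x d a b c))
      (Ideal.span (Set.range (pA (A := WeylAlgebra m) x d a b c))) := by
  refine isGroebnerBasis_range (q := pA x d (a + 1) b c) (pA_ne_zero a b c) ?_ ?_
    (weylRelations_x_d.pA_add_one_mul_pA a b c)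
  · exact fun i j hij => by simpa only [degree_symbol_pA] using disjoint_leadExp hij
  · simp only [initialTerm_pA, implies_true]

end GroebnerBasis

section CoordinateChange

variable {m : ℕ} {A B : Type*} [Ring A] [Algebra ℂ A] [Ring B] [Algebra ℂ B]

theorem pA_eq_neg_mul_map_ellA {x d : Fin m → A} {x' d' : Fin m → B} (σ : A →ₐ[ℂ] B)
    (hθ : ∀ j, σ (euler x d j) = -euler x' d' j) {i : Fin m} (hx : x' i * σ (x i) = 1)
    (a : ℂ) (b c : Fin m → ℂ) :
    pA x' d' a b c i = -(x' i * σ (ellA x d a b c i)) := by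
  simp only [ellA, map_sub, map_mul, map_add, map_sum, AlgHom.commutes, hθ,
    Finset.sum_neg_distrib, mul_sub, ← mul_assoc, hx, one_mul, pA]
  noncomm_ring

end CoordinateChange

section Torus

variable {m : ℕ}

theorem laurentX_single (i : Fin m) (n : Fin m → ℤ) (z : ℂ) :
    laurentX i (AddMonoidAlgebra.single n z) = AddMonoidAlgebra.single (n + Pi.single i 1) z := by
  rw [laurentX, LinearMap.mulLeft_apply, AddMonoidAlgebra.single_mul_single, one_mul, add_comm]

theorem euler_laurent_single (i : Fin m) (n : Fin m → ℤ) :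
    euler laurentX laurentD i (AddMonoidAlgebra.single n 1) =
      AddMonoidAlgebra.single n (n i : ℂ) := by
  rw [euler, Module.End.mul_apply, laurentD, ← AddMonoidAlgebra.basis_apply,
    Module.Basis.constr_basis, laurentX_single, sub_add_cancel]

theorem laurentInv_single (n : Fin m → ℤ) (z : ℂ) :
    laurentInv m (AddMonoidAlgebra.single n z) = AddMonoidAlgebra.single (-n) z :=
  AddMonoidAlgebra.domCongr_single ..

theorem invertCoordinates_single (P : Module.End ℂ (Laurent m)) (n : Fin m → ℤ) (z : ℂ) :
    invertCoordinates P (AddMonoidAlgebra.single n z) =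
      laurentInv m (P (AddMonoidAlgebra.single (-n) z)) := by
  have hsymm : (laurentInv m).symm (AddMonoidAlgebra.single n z) =
      AddMonoidAlgebra.single (-n) z := by
    rw [AlgEquiv.symm_apply_eq, laurentInv_single, neg_neg]
  rw [← hsymm]
  rfl

theorem invertCoordinates_euler (i : Fin m) :
    invertCoordinates (euler laurentX laurentD i) = -euler laurentX laurentD i := by
  refine (AddMonoidAlgebra.basis (Fin m → ℤ) ℂ).ext fun n => ?_
  rw [AddMonoidAlgebra.basis_apply, invertCoordinates_single, euler_laurent_single,
    laurentInv_single, neg_neg, LinearMap.neg_apply, euler_laurent_single,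
    ← AddMonoidAlgebra.single_neg, Pi.neg_apply, Int.cast_neg]

theorem laurentX_mul_invertCoordinates_laurentX (i : Fin m) :
    laurentX i * invertCoordinates (laurentX i) = 1 := by
  refine (AddMonoidAlgebra.basis (Fin m → ℤ) ℂ).ext fun n => ?_
  rw [AddMonoidAlgebra.basis_apply, Module.End.mul_apply, invertCoordinates_single,
    laurentX_single, laurentInv_single, laurentX_single, neg_add, neg_neg, neg_add_cancel_right,
    Module.End.one_apply]

theorem pA_laurent_eq_neg_laurentX_mul_invertCoordinates_ellA (a : ℂ) (b c : Fin m → ℂ)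
    (i : Fin m) :
    pA laurentX laurentD a b c i =
      -(laurentX i * invertCoordinates (ellA laurentX laurentD a b c i)) :=
  pA_eq_neg_mul_map_ellA ((laurentInv m).toLinearEquiv.conjAlgEquiv ℂ).toAlgHom
    invertCoordinates_euler (laurentX_mul_invertCoordinates_laurentX i) a b c

end Torus

end Lauricella

end

theorem mainTheorem8 (m : ℕ) (a : ℂ) (b c : Fin m → ℂ) :
    (∀ i : Fin m,
      Lauricella.pA Lauricella.laurentX Lauricella.laurentD a b c i =
        -(Lauricella.laurentX i * Lauricella.invertCoordinates
          (Lauricella.ellA Lauricella.laurentX Lauricella.laurentD a b c i))) ∧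
    (∀ t : MonomialOrder (Fin m ⊕ Fin m),
      Lauricella.IsGroebnerBasis (Lauricella.zeroOneOrder t)
        (Set.range (Lauricella.pA (A := Lauricella.WeylAlgebra m)
          Lauricella.x Lauricella.d a b c))
        (Ideal.span (Set.range (Lauricella.pA (A := Lauricella.WeylAlgebra m)
          Lauricella.x Lauricella.d a b c)))) ∧
    (∀ (a' b' : Fin m → ℂ) (c' : ℂ) (i : Fin m),
      Lauricella.initialForm (Lauricella.pA Lauricella.x Lauricella.d a b c i) =
        Lauricella.initialForm (Lauricella.ellB Lauricella.x Lauricella.d a' b' c' i)) := by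
  exact ⟨Lauricella.pA_laurent_eq_neg_laurentX_mul_invertCoordinates_ellA a b c,
    Lauricella.isGroebnerBasis_pA a b c,
    Lauricella.initialForm_pA_eq_initialForm_ellB a b c⟩
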